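/- Let $m\ge 1$ and let $\mathfrak g=\bigoplus_{i\in\mathbb Z/m}\mathfrak g_i$ be a finite-dimensional real $\mathbb Z/m$-graded semisimple Lie algebra, with complexification $\mathfrak g^{\mathbb C}=\bigoplus_i\mathfrak g_i^{\mathbb C}$. Let $\tau_{\mathfrak g}$ be the complex conjugation of $\mathfrak g^{\mathbb C}$ with respect to $\mathfrak g$, and let $\theta^{\mathbb C}$ be the automorphism of $\mathfrak g^{\mathbb C}$ acting on $\mathfrak g_k^{\mathbb C}$ as multiplication by $e^{2\pi\sqrt{-1}\,k/m}$. Let $\mathfrak u$ be a compact real form of $\mathfrak g^{\mathbb C}$ whose complex conjugation $\tau_{\mathfrak u}$ commutes with $\tau_{\mathfrak g}$; the restriction of $\tau_{\mathfrak u}$ to $\mathfrak g$ is a Cartan involution of $\mathfrak g$, again denoted $\tau_{\mathfrak u}$. Assume that $\tau_{\mathfrak u}$ is R-compatible with the gradation, that is, $\tau_{\mathfrak u}\theta^{\mathbb C}=\theta^{\mathbb C}\tau_{\mathfrak u}$ on $\mathfrak g^{\mathbb C}$. Let $\tau_{\mathfrak u}^{\mathbb C}$ be the $\mathbb C$-linear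 extension to $\mathfrak g^{\mathbb C}$ of $\tau_{\mathfrak u}:\mathfrak g\to\mathfrak g$. Let $G_0$ (resp. $G_0^{\mathbb C}$) be the connected Lie subgroup with Lie algebra $\mathfrak g_0$ (resp. $\mathfrak g_0^{\mathbb C}$) of a connected Lie group with Lie algebra $\mathfrak g$ (resp. $\mathfrak g^{\mathbb C}$); thus $Ad_{G_0}$ (resp. $Ad_{G_0^{\mathbb C}}$) is the group of linear transformations of $\mathfrak g$ (resp. $\mathfrak g^{\mathbb C}$) generated by all $e^{\mathrm{ad}\,x}$ with $x\in\mathfrak g_0$ (resp. $x\in\mathfrak g_0^{\mathbb C}$). Then for every $i\in\mathbb Z/m$: 1. $\tau_{\mathfrak u}$ maps $\mathfrak g_i$ bijectively onto $\mathfrak g_{-i}$, $\tau_{\mathfrak u}(Ad_{G_0}e)=Ad_{G_0}(\tau_{\mathfrak u}e)$ for every $e\in\mathfrak g_i$, and $O\mapsto\tau_{\mathfrak u}(O)$ is a bijection from the set of $Ad_{G_0}$-orbits in $\mathfrak g_i$ onto the set of $Ad_{G_0}$-orbits in $\mathfrak g_{-i}$. 2. $\tau_{\mathfrak u}^{\mathbb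 C}=\tau_{\mathfrak u}\circ\tau_{\mathfrak g}$ on $\mathfrak g^{\mathbb C}$, $\tau_{\mathfrak u}^{\mathbb C}$ maps $\mathfrak g_i^{\mathbb C}$ bijectively onto $\mathfrak g_{-i}^{\mathbb C}$, $\tau_{\mathfrak u}^{\mathbb C}(Ad_{G_0^{\mathbb C}}e)=Ad_{G_0^{\mathbb C}}(\tau_{\mathfrak u}^{\mathbb C}e)$ for every $e\in\mathfrak g_i^{\mathbb C}$, and $O\mapsto\tau_{\mathfrak u}^{\mathbb C}(O)$ is a bijection from the set of $Ad_{G_0^{\mathbb C}}$-orbits in $\mathfrak g_i^{\mathbb C}$ onto the set of $Ad_{G_0^{\mathbb C}}$-orbits in $\mathfrak g_{-i}^{\mathbb C}$. -/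

import Mathlib

open scoped TensorProduct

noncomputable section

namespace GradedLie

/-! ### Exponentials and adjoint orbits -/

section Exponential

variable {K : Type*} [NontriviallyNormedField K]

/-- The exponential `exp T = ∑ Tⁿ / n!` of an endomorphism `T` of a finite-dimensional vector space
`V`; the series is summed in the canonical topology of the finite-dimensional algebra `End V`. -/
def endExp {V : Type*} [AddCommGroup V] [Module K V] [FiniteDimensional K V]
    (T : Module.End K V) : Module.End K V :=
  letI : TopologicalSpace (Module.End K V) := moduleTopology K (Module.End K V)
  haveI : IsModuleTopology K (Module.End K V) := ⟨rfl⟩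
  haveI : IsTopologicalRing (Module.End K V) := IsModuleTopology.isTopologicalRing K _
  NormedSpace.exp T

variable {L : Type*} [LieRing L] [LieAlgebra K L] [FiniteDimensional K L]

/-- For a subalgebra `h` of a finite-dimensional Lie algebra `L`, the group `Ad_H` of linear
transformations of `L`, where `H` is the connected Lie subgroup with Lie algebra `h` of any
connected Lie group with Lie algebra `L`. Since `H` is generated by `exp h` and
`Ad (exp x) = exp (ad x)`, this is the subgroup of `GL(L)` generated by all `exp (ad x)`,
`x ∈ h`. -/
def adGroup (h : Submodule K L) : Subgroup (L ≃ₗ[K] L) :=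
  Subgroup.closure
    {S : L ≃ₗ[K] L | ∃ x ∈ h, (S : Module.End K L) = endExp (LieAlgebra.ad K L x)}

/-- The orbit `Ad_H (e)` of a point `e ∈ L`. -/
def adOrbit (h : Submodule K L) (e : L) : Set L :=
  {y | ∃ S ∈ adGroup h, S e = y}

/-- The set of all `Ad_H`-orbits of the elements of a subspace `W` of `L`. -/
def adOrbits (h W : Submodule K L) : Set (Set L) :=
  {O | ∃ e ∈ W, O = adOrbit h e}

end Exponential

/-! ### The complexification and its real forms -/

section RealForms

variable (g : Type*) [LieRing g] [LieAlgebra ℝ g]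

/-- The complex conjugation `τ_g` of the complexification `g^ℂ = ℂ ⊗ g` with respect to the real
form `g`, that is, `c ⊗ x ↦ conj c ⊗ x`. -/
def tauG : (ℂ ⊗[ℝ] g) →ₗ[ℝ] (ℂ ⊗[ℝ] g) :=
  LinearMap.rTensor g Complex.conjAe.toLinearMap

/-- Multiplication by `√-1` on `g^ℂ`, as a real linear map. -/
def mulI : (ℂ ⊗[ℝ] g) →ₗ[ℝ] (ℂ ⊗[ℝ] g) :=
  (LinearMap.lsmul ℂ (ℂ ⊗[ℝ] g) Complex.I).restrictScalars ℝ

variable {g}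

/-- A real Lie subalgebra `u` of `g^ℂ` is a real form if `g^ℂ = u ⊕ √-1 u` as real vector spaces. -/
def IsRealForm (u : LieSubalgebra ℝ (ℂ ⊗[ℝ] g)) : Prop :=
  IsCompl u.toSubmodule (u.toSubmodule.map (mulI g))

/-- The complex conjugation `x + √-1 y ↦ x - √-1 y` (`x, y ∈ u`) of `g^ℂ` with respect to a real
form `u`. -/
def conjugation {u : LieSubalgebra ℝ (ℂ ⊗[ℝ] g)} (hu : IsRealForm u) :
    (ℂ ⊗[ℝ] g) →ₗ[ℝ] (ℂ ⊗[ℝ] g) :=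
  Submodule.projection _ _ hu - Submodule.projection _ _ hu.symm

theorem conjugation_apply {u : LieSubalgebra ℝ (ℂ ⊗[ℝ] g)} (hu : IsRealForm u)
    {x y : ℂ ⊗[ℝ] g} (hx : x ∈ u) (hy : y ∈ u) :
    conjugation hu (x + Complex.I • y) = x - Complex.I • y := by
  have hy' : Complex.I • y ∈ u.toSubmodule.map (mulI g) := ⟨y, hy, rfl⟩
  have hx' : x ∈ u.toSubmodule := hx
  have e1 : Submodule.projection _ _ hu (Complex.I • y) = 0 :=
    Submodule.projection_apply_right hu ⟨_, hy'⟩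
  have e2 : Submodule.projection _ _ hu.symm x = 0 :=
    Submodule.projection_apply_right hu.symm ⟨_, hx'⟩
  simp [conjugation, e1, e2, Submodule.projection_apply_of_mem_left hu hx',
    Submodule.projection_apply_of_mem_left hu.symm hy']

/-- A real form `u` is compact if its Killing form is negative definite. -/
def IsCompactRealForm (u : LieSubalgebra ℝ (ℂ ⊗[ℝ] g)) : Prop :=
  IsRealForm u ∧ ∀ x : u, x ≠ 0 → killingForm ℝ u x x < 0

end RealForms

/-! ### Cartan involutions -/

section Cartan

variable (g : Type*) [LieRing g] [LieAlgebra ℝ g]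

/-- The data of a Cartan involution `τ_u` of `g`: a compact real form `u` of `g^ℂ` which is
compatible with `g`, that is, `τ_g τ_u = τ_u τ_g`. -/
structure CartanInvolution where
  /-- the compact real form -/
  u : LieSubalgebra ℝ (ℂ ⊗[ℝ] g)
  isCompactRealForm : IsCompactRealForm u
  compatible : tauG g ∘ₗ conjugation isCompactRealForm.1 =
    conjugation isCompactRealForm.1 ∘ₗ tauG g

/-- The real part `c ⊗ x ↦ Re c • x`, a left inverse of the inclusion `x ↦ 1 ⊗ x` of `g`. -/
def rePart : (ℂ ⊗[ℝ] g) →ₗ[ℝ] g :=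
  (TensorProduct.lid ℝ g).toLinearMap ∘ₗ LinearMap.rTensor g Complex.reLm

theorem one_tmul_rePart {z : ℂ ⊗[ℝ] g} (hz : tauG g z = z) :
    (1 : ℂ) ⊗ₜ[ℝ] rePart g z = z := by
  have key : ∀ w : ℂ ⊗[ℝ] g, w + tauG g w = (2 : ℝ) • (1 : ℂ) ⊗ₜ[ℝ] rePart g w := by
    intro w
    induction w using TensorProduct.induction_on with
    | zero => simp
    | tmul a x =>
      have h : a + (starRingEnd ℂ) a = (2 * a.re : ℝ) • (1 : ℂ) := by
        apply Complex.ext <;> simp; ring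
      have h' : tauG g (a ⊗ₜ[ℝ] x) = (starRingEnd ℂ) a ⊗ₜ[ℝ] x := rfl
      have h2 : rePart g (a ⊗ₜ[ℝ] x) = a.re • x := rfl
      rw [h', h2, ← TensorProduct.add_tmul, h, TensorProduct.smul_tmul, TensorProduct.tmul_smul,
        TensorProduct.tmul_smul, smul_smul]
    | add a b ha hb =>
      rw [map_add, map_add, TensorProduct.tmul_add, smul_add, ← ha, ← hb]
      abel
  have h := key z
  rw [hz, ← two_smul ℝ] at h
  exact (smul_right_injective _ (two_ne_zero : (2 : ℝ) ≠ 0) h).symm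

namespace CartanInvolution

variable {g} (c : CartanInvolution g)

/-- The conjugation `τ_u` of `g^ℂ`. -/
def conj : (ℂ ⊗[ℝ] g) →ₗ[ℝ] (ℂ ⊗[ℝ] g) :=
  conjugation c.isCompactRealForm.1

/-- The Cartan involution `τ_u : g → g`: the restriction to `g` of the conjugation `τ_u` of `g^ℂ`.
The latter maps `g` to itself because it commutes with `τ_g`, see
`CartanInvolution.one_tmul_tau`. -/
def tau : g →ₗ[ℝ] g :=
  rePart g ∘ₗ c.conj ∘ₗ TensorProduct.mk ℝ ℂ g 1

theorem one_tmul_tau (x : g) : (1 : ℂ) ⊗ₜ[ℝ] c.tau x = c.conj ((1 : ℂ) ⊗ₜ[ℝ] x) := by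
  apply one_tmul_rePart
  have h := LinearMap.congr_fun c.compatible ((1 : ℂ) ⊗ₜ[ℝ] x)
  simp only [LinearMap.comp_apply] at h
  have h1 : tauG g ((1 : ℂ) ⊗ₜ[ℝ] x) = (1 : ℂ) ⊗ₜ[ℝ] x := by simp [tauG]
  rw [h1] at h
  exact h

/-- The `ℂ`-linear extension `τ_u^ℂ : g^ℂ → g^ℂ` of the Cartan involution `τ_u : g → g`. -/
def tauC : (ℂ ⊗[ℝ] g) →ₗ[ℂ] (ℂ ⊗[ℝ] g) :=
  c.tau.baseChange ℂ

end CartanInvolution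

end Cartan

/-! ### Gradations -/

section Gradation

variable {g : Type*} [LieRing g] [LieAlgebra ℝ g] {m : ℕ} [NeZero m]

/-- The automorphism `θ^ℂ` of `g^ℂ` associated with the `ℤ/m`-gradation: multiplication by
`exp (2π√-1 k / m)` on `g_k^ℂ`. It is the sum over `k` of these scalars times the `ℂ`-linear
extension of the projection of `g` onto `g_k`. -/
def thetaC (𝒜 : ZMod m → Submodule ℝ g) [GradedLieAlgebra 𝒜] :
    (ℂ ⊗[ℝ] g) →ₗ[ℂ] (ℂ ⊗[ℝ] g) :=
  ∑ k : ZMod m, Complex.exp (2 * Real.pi * Complex.I * (k.val : ℂ) / (m : ℂ)) •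
    ((𝒜 k).subtype ∘ₗ DirectSum.component ℝ (ZMod m) (fun j => 𝒜 j) k ∘ₗ
      (DirectSum.decomposeLinearEquiv 𝒜).toLinearMap).baseChange ℂ

theorem thetaC_apply (𝒜 : ZMod m → Submodule ℝ g) [GradedLieAlgebra 𝒜] (k : ZMod m)
    {z : ℂ ⊗[ℝ] g} (hz : z ∈ (𝒜 k).baseChange ℂ) :
    thetaC 𝒜 z = Complex.exp (2 * Real.pi * Complex.I * (k.val : ℂ) / (m : ℂ)) • z := by
  have hp : ∀ (j : ZMod m) (x : g), x ∈ 𝒜 k →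
      ((𝒜 j).subtype ∘ₗ DirectSum.component ℝ (ZMod m) (fun j => 𝒜 j) j ∘ₗ
      (DirectSum.decomposeLinearEquiv 𝒜).toLinearMap) x = if j = k then x else 0 := by
    intro j x hx
    have : ((DirectSum.decompose 𝒜 x) j : g) = if j = k then x else 0 := by
      split_ifs with h
      · subst h
        exact DirectSum.decompose_of_mem_same 𝒜 hx
      · exact DirectSum.decompose_of_mem_ne 𝒜 hx (Ne.symm h)
    exact this
  rw [Submodule.baseChange_eq_span] at hz
  induction hz using Submodule.span_induction with
  | mem z hz =>
    obtain ⟨x, hx, rfl⟩ := hz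
    rw [thetaC, LinearMap.sum_apply, Finset.sum_eq_single k]
    · simp [hp k x hx]
    · intro j _ hj
      simp [hp j x hx, hj]
    · simp
  | zero => simp
  | add a b _ _ ha hb => rw [map_add, ha, hb, smul_add]
  | smul r a _ ha => rw [map_smul, ha, smul_comm]

/-- A Cartan involution `τ_u` is R-compatible with the gradation if `u` is invariant under `θ^ℂ`,
in the form `τ_u θ^ℂ = θ^ℂ τ_u`. -/
def CartanInvolution.IsRCompatible (c : CartanInvolution g)
    (𝒜 : ZMod m → Submodule ℝ g) [GradedLieAlgebra 𝒜] : Prop :=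
  ∀ z : ℂ ⊗[ℝ] g, c.conj (thetaC 𝒜 z) = thetaC 𝒜 (c.conj z)

end Gradation

end GradedLie

end

open scoped TensorProduct

namespace GradedLie

/-! ### Automorphisms acting on adjoint groups and their orbits. -/

section Exponential

variable {K : Type*} [RCLike K]

/-! Both `tau` and `tauC` are involutive Lie algebra automorphisms. On `g_i` the map `θ^ℂ` is the
scalar `ζ^i`, `ζ = exp (2π√-1 / m)`; since `τ_u` is antilinear and commutes with `θ^ℂ`, it turns
this eigenvalue into its conjugate `ζ^(-i)`, so `g_i` goes to `g_{-i}` (`tau_mem`, and `tauC_mem` by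
linear extension). In particular degree `0` is preserved. An automorphism `φ` preserving `h`
satisfies `φ exp(ad x) φ⁻¹ = exp(ad (φ x))`, hence normalizes `Ad_H` and permutes its orbits
(`conj_mem_adGroup`, `image_adOrbit`). `involution_adOrbits` packages this over `ℝ` and `ℂ` at once.
-/

theorem t2Space_moduleTopology (V : Type*) [AddCommGroup V] [Module K V]
    [FiniteDimensional K V] : @T2Space V (moduleTopology K V) := by
  let : TopologicalSpace V := moduleTopology K V
  have : IsModuleTopology K V := ⟨rfl⟩
  let e := (Module.finBasis K V).equivFun
  exact T2Space.of_injective_continuous e.injective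
    (IsModuleTopology.continuous_of_linearMap e.toLinearMap)

/-- Conjugation by `φ` is a linear homeomorphism of `End V`, so it passes through the series, and an
algebra map, so it passes through powers. No summability is needed, because `Φ` is an equivalence
and `End V` is Hausdorff. -/
theorem endExp_conj {V : Type*} [AddCommGroup V] [Module K V] [FiniteDimensional K V]
    (φ : V ≃ₗ[K] V) (T : Module.End K V) : endExp (φ.conj T) = φ.conj (endExp T) := by
  let : TopologicalSpace (Module.End K V) := moduleTopology K (Module.End K V)
  have : IsModuleTopology K (Module.End K V) := ⟨rfl⟩
  have : IsTopologicalRing (Module.End K V) := IsModuleTopology.isTopologicalRing K _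
  have : T2Space (Module.End K V) := t2Space_moduleTopology (K := K) _
  let Φ : Module.End K V ≃L[K] Module.End K V :=
    { φ.conj with
      continuous_toFun := IsModuleTopology.continuous_of_linearMap φ.conj.toLinearMap
      continuous_invFun := IsModuleTopology.continuous_of_linearMap φ.conj.symm.toLinearMap }
  have hΦ (S : Module.End K V) : Φ S = φ.conj S := rfl
  have hpow (n : ℕ) : φ.conj (T ^ n) = φ.conj T ^ n := map_pow (φ.conjAlgEquiv K) T n
  change NormedSpace.exp (φ.conj T) = φ.conj (NormedSpace.exp T)
  rw [NormedSpace.exp_eq_tsum K, ← hΦ (∑' n : ℕ, _), Φ.map_tsum]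
  simp only [map_smul, hΦ, hpow]

variable {L : Type*} [LieRing L] [LieAlgebra K L] [FiniteDimensional K L]

/-- Since `φ ∘ ad x ∘ φ⁻¹ = ad (φ x)`, conjugation by `φ` sends generators to generators. -/
theorem conj_mem_adGroup {h : Submodule K L} (φ : L ≃ₗ⁅K⁆ L) (hφ : ∀ x ∈ h, φ x ∈ h)
    {S : L ≃ₗ[K] L} (hS : S ∈ adGroup h) :
    φ.toLinearEquiv * S * φ.toLinearEquiv⁻¹ ∈ adGroup h := by
  rw [← MulAut.conj_apply]
  change S ∈ (adGroup h).comap (MulAut.conj φ.toLinearEquiv).toMonoidHom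
  refine (Subgroup.closure_le _).2 ?_ hS
  rintro S ⟨x, hx, hSx⟩
  refine Subgroup.subset_closure ⟨φ x, hφ x hx, ?_⟩
  have : LieAlgebra.ad K L (φ x) = φ.toLinearEquiv.conj (LieAlgebra.ad K L x) := by
    ext y
    simp only [LinearEquiv.conj_apply, LinearMap.comp_apply, LieAlgebra.ad_apply]
    change ⁅φ x, y⁆ = φ ⁅x, φ.symm y⁆
    rw [LieEquiv.map_lie, φ.apply_symm_apply]
  rw [this, endExp_conj, ← hSx]
  rfl

theorem image_adOrbit_subset {h : Submodule K L} (φ : L ≃ₗ⁅K⁆ L) (hφ : ∀ x ∈ h, φ x ∈ h)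
    (e : L) : φ '' adOrbit h e ⊆ adOrbit h (φ e) := by
  rintro _ ⟨_, ⟨S, hS, rfl⟩, rfl⟩
  exact ⟨_, conj_mem_adGroup φ hφ hS, congrArg (fun y => φ (S y)) (φ.symm_apply_apply e)⟩

theorem image_adOrbit {h : Submodule K L} (φ : L ≃ₗ⁅K⁆ L) (hφ : ∀ x ∈ h, φ x ∈ h)
    (hφ' : ∀ x ∈ h, φ.symm x ∈ h) (e : L) : φ '' adOrbit h e = adOrbit h (φ e) := by
  refine (image_adOrbit_subset φ hφ e).antisymm fun y hy => ⟨φ.symm y, ?_, by simp⟩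
  simpa using image_adOrbit_subset φ.symm hφ' (φ e) ⟨y, hy, rfl⟩

theorem bijOn_image_adOrbits {h W W' : Submodule K L} (φ : L ≃ₗ⁅K⁆ L)
    (hφ : ∀ x ∈ h, φ x ∈ h) (hφ' : ∀ x ∈ h, φ.symm x ∈ h) (hW : Set.BijOn φ W W') :
    Set.BijOn (fun O => φ '' O) (adOrbits h W) (adOrbits h W') := by
  refine ⟨?_, φ.injective.image_injective.injOn, ?_⟩
  · rintro _ ⟨e, he, rfl⟩
    exact ⟨φ e, hW.mapsTo he, image_adOrbit φ hφ hφ' e⟩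
  · rintro _ ⟨e, he, rfl⟩
    obtain ⟨e', he', rfl⟩ := hW.surjOn he
    exact ⟨adOrbit h e', ⟨e', he', rfl⟩, image_adOrbit φ hφ hφ' e'⟩

/-- A Lie algebra endomorphism squaring to the identity, as an automorphism. -/
def involutionEquiv (f : L →ₗ[K] L) (hf : ∀ x y, f ⁅x, y⁆ = ⁅f x, f y⁆)
    (hff : ∀ x, f (f x) = x) : L ≃ₗ⁅K⁆ L :=
  { f with
    map_lie' := fun {x y} => hf x y
    invFun := f
    left_inv := hff
    right_inv := hff }

/-- A Lie algebra involution preserving `h` and exchanging `W` and `W'` transports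
`Ad_H`-orbits. -/
theorem involution_adOrbits {h W W' : Submodule K L} (f : L →ₗ[K] L)
    (hf : ∀ x y, f ⁅x, y⁆ = ⁅f x, f y⁆) (hff : ∀ x, f (f x) = x) (hh : ∀ x ∈ h, f x ∈ h)
    (hW : ∀ x ∈ W, f x ∈ W') (hW' : ∀ x ∈ W', f x ∈ W) :
    Set.BijOn f W W' ∧ (∀ e ∈ W, f '' adOrbit h e = adOrbit h (f e)) ∧
      Set.BijOn (fun O => f '' O) (adOrbits h W) (adOrbits h W') := by
  have hbij : Set.BijOn f W W' :=
    ⟨hW, (Function.LeftInverse.injective hff).injOn, fun x hx => ⟨f x, hW' x hx, hff x⟩⟩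
  exact ⟨hbij, fun e _ => image_adOrbit (involutionEquiv f hf hff) hh hh e,
    bijOn_image_adOrbits (involutionEquiv f hf hff) hh hh hbij⟩

end Exponential

/-! ### Conjugations are antilinear involutive automorphisms. -/

section RealForms

variable {g : Type*} [LieRing g] [LieAlgebra ℝ g]

theorem IsRealForm.exists_eq_add {u : LieSubalgebra ℝ (ℂ ⊗[ℝ] g)} (hu : IsRealForm u)
    (z : ℂ ⊗[ℝ] g) : ∃ x ∈ u, ∃ y ∈ u, z = x + Complex.I • y := by
  have hz : z ∈ u.toSubmodule ⊔ u.toSubmodule.map (mulI g) := hu.sup_eq_top ▸ Submodule.mem_top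
  obtain ⟨x, hx, _, ⟨y, hy, rfl⟩, rfl⟩ := Submodule.mem_sup.1 hz
  exact ⟨x, hx, y, hy, rfl⟩

variable {u : LieSubalgebra ℝ (ℂ ⊗[ℝ] g)} (hu : IsRealForm u)

theorem conjugation_conjugation (z : ℂ ⊗[ℝ] g) : conjugation hu (conjugation hu z) = z := by
  obtain ⟨x, hx, y, hy, rfl⟩ := hu.exists_eq_add z
  rw [conjugation_apply hu hx hy, sub_eq_add_neg, ← smul_neg,
    conjugation_apply hu hx (neg_mem hy), smul_neg, sub_neg_eq_add]

theorem conjugation_I_smul (z : ℂ ⊗[ℝ] g) :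
    conjugation hu (Complex.I • z) = -(Complex.I • conjugation hu z) := by
  obtain ⟨x, hx, y, hy, rfl⟩ := hu.exists_eq_add z
  have h : Complex.I • (x + Complex.I • y) = -y + Complex.I • x := by
    rw [smul_add, smul_smul, Complex.I_mul_I, neg_one_smul, add_comm]
  rw [h, conjugation_apply hu hx hy, conjugation_apply hu (neg_mem hy) hx, smul_sub, smul_smul,
    Complex.I_mul_I, neg_one_smul]
  abel

theorem conjugation_smul (a : ℂ) (z : ℂ ⊗[ℝ] g) :
    conjugation hu (a • z) = (starRingEnd ℂ) a • conjugation hu z := by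
  have h (b : ℂ) (w : ℂ ⊗[ℝ] g) : b • w = b.re • w + b.im • Complex.I • w := by
    rw [← algebraMap_smul ℂ b.re, ← algebraMap_smul ℂ b.im, smul_smul, ← add_smul]
    exact congrArg (· • w) (Complex.re_add_im b).symm
  rw [h a z, h _ (conjugation hu z), map_add, map_smul, map_smul, conjugation_I_smul]
  simp

/-- The bracket is `ℂ`-bilinear and `u` is closed under it, so the `u` and `√-1 u` components of
`⁅z, w⁆` are explicit. -/
theorem conjugation_lie (z w : ℂ ⊗[ℝ] g) :
    conjugation hu ⁅z, w⁆ = ⁅conjugation hu z, conjugation hu w⁆ := by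
  obtain ⟨x, hx, y, hy, rfl⟩ := hu.exists_eq_add z
  obtain ⟨x', hx', y', hy', rfl⟩ := hu.exists_eq_add w
  let B := LieAlgebra.ad ℂ (ℂ ⊗[ℝ] g)
  have h : B (x + Complex.I • y) (x' + Complex.I • y') =
      (B x x' - B y y') + Complex.I • (B x y' + B y x') := by
    simp only [map_add, map_smul, LinearMap.add_apply, LinearMap.smul_apply, smul_smul,
      Complex.I_mul_I, neg_one_smul, smul_add]
    abel
  have hB {a b : ℂ ⊗[ℝ] g} (ha : a ∈ u) (hb : b ∈ u) : B a b ∈ u := u.lie_mem ha hb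
  change conjugation hu (B _ _) = B _ _
  rw [h, conjugation_apply hu hx hy, conjugation_apply hu hx' hy',
    conjugation_apply hu (sub_mem (hB hx hx') (hB hy hy'))
      (add_mem (hB hx hy') (hB hy hx'))]
  simp only [map_sub, map_smul, LinearMap.sub_apply, LinearMap.smul_apply, smul_smul,
    smul_sub, Complex.I_mul_I, neg_one_smul, smul_add]
  abel

end RealForms

/-! ### The Cartan involution and its complex-linear extension. -/

section Cartan

variable {g : Type*} [LieRing g] [LieAlgebra ℝ g]

/-- Lets identities in `g` be checked in `g^ℂ`, where `tau` becomes `conj`. -/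
theorem one_tmul_injective : Function.Injective fun x : g => (1 : ℂ) ⊗ₜ[ℝ] x := by
  refine Function.LeftInverse.injective (g := rePart g) fun x => ?_
  simp [rePart]

namespace CartanInvolution

variable (c : CartanInvolution g)

theorem tau_tau (x : g) : c.tau (c.tau x) = x :=
  one_tmul_injective <| by
    simp only [one_tmul_tau]
    exact conjugation_conjugation _ _

theorem tau_lie (x y : g) : c.tau ⁅x, y⁆ = ⁅c.tau x, c.tau y⁆ :=
  one_tmul_injective <| by
    have h (a b : g) : (1 : ℂ) ⊗ₜ[ℝ] ⁅a, b⁆ = ⁅(1 : ℂ) ⊗ₜ[ℝ] a, (1 : ℂ) ⊗ₜ[ℝ] b⁆ := by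
      rw [LieAlgebra.ExtendScalars.bracket_tmul, one_mul]
    simp only [one_tmul_tau, h]
    exact conjugation_lie _ _ _

theorem tauC_tmul (a : ℂ) (x : g) : c.tauC (a ⊗ₜ[ℝ] x) = a ⊗ₜ[ℝ] c.tau x := rfl

theorem tauC_tauC (z : ℂ ⊗[ℝ] g) : c.tauC (c.tauC z) = z := by
  induction z using TensorProduct.induction_on with
  | zero => simp
  | tmul a x => rw [tauC_tmul, tauC_tmul, tau_tau]
  | add a b ha hb => rw [map_add, map_add, ha, hb]

theorem tauC_lie (z w : ℂ ⊗[ℝ] g) : c.tauC ⁅z, w⁆ = ⁅c.tauC z, c.tauC w⁆ := by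
  let B := LieAlgebra.ad ℂ (ℂ ⊗[ℝ] g)
  change c.tauC (B z w) = B (c.tauC z) (c.tauC w)
  induction z using TensorProduct.induction_on with
  | zero => simp
  | add a b ha hb => simp only [map_add, LinearMap.add_apply, ha, hb]
  | tmul a x =>
    induction w using TensorProduct.induction_on with
    | zero => simp
    | add b b' hb hb' => simp only [map_add, hb, hb']
    | tmul b y =>
      have h (x y : g) : B (a ⊗ₜ[ℝ] x) (b ⊗ₜ[ℝ] y) = (a * b) ⊗ₜ[ℝ] ⁅x, y⁆ := rfl
      rw [h, tauC_tmul, tauC_tmul, tauC_tmul, h, tau_lie]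

/-- On `a ⊗ x`, `τ_g` conjugates the scalar `a` and the antilinear `τ_u` conjugates it back. -/
theorem tauC_eq (z : ℂ ⊗[ℝ] g) : c.tauC z = c.conj (tauG g z) := by
  induction z using TensorProduct.induction_on with
  | zero => simp
  | add a b ha hb => simp only [map_add, ha, hb]
  | tmul a x =>
    have h : tauG g (a ⊗ₜ[ℝ] x) = (starRingEnd ℂ) a • (1 : ℂ) ⊗ₜ[ℝ] x := by
      rw [TensorProduct.smul_tmul', smul_eq_mul, mul_one]; rfl
    rw [h, conj, conjugation_smul, ← conj, ← one_tmul_tau, Complex.conj_conj,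
      TensorProduct.smul_tmul', smul_eq_mul, mul_one, tauC_tmul]

end CartanInvolution

end Cartan

/-! ### Homogeneous components as eigenspaces of `θ^ℂ`. -/

section Gradation

variable {g : Type*} [LieRing g] [LieAlgebra ℝ g] {m : ℕ} [NeZero m]
  (𝒜 : ZMod m → Submodule ℝ g) [GradedLieAlgebra 𝒜]

/-- Writing the eigenvalue as an additive character gives access to its injectivity and to
conjugation as negation of `k`. -/
theorem thetaC_one_tmul (k : ZMod m) {x : g} (hx : x ∈ 𝒜 k) :
    thetaC 𝒜 ((1 : ℂ) ⊗ₜ[ℝ] x) = ZMod.stdAddChar k • (1 : ℂ) ⊗ₜ[ℝ] x := by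
  rw [thetaC_apply 𝒜 k (Submodule.tmul_mem_baseChange_of_mem _ hx), ZMod.stdAddChar_apply,
    ZMod.toCircle_apply]

/-- Elements of `g` in the eigenspace of `θ^ℂ` for `exp (2π√-1 k / m)` are homogeneous of
degree `k`. -/
theorem mem_of_thetaC_eq {k : ZMod m} {x : g}
    (h : thetaC 𝒜 ((1 : ℂ) ⊗ₜ[ℝ] x) = ZMod.stdAddChar k • (1 : ℂ) ⊗ₜ[ℝ] x) : x ∈ 𝒜 k := by
  classical
  have hsum := DirectSum.sum_support_decompose 𝒜 x
  have hzero (j : ZMod m) (hj : j ≠ k) : (DirectSum.decompose 𝒜 x j : g) = 0 := by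
    let p : g →ₗ[ℝ] g := (𝒜 j).subtype ∘ₗ DirectSum.component ℝ (ZMod m) (fun j => 𝒜 j) j ∘ₗ
      (DirectSum.decomposeLinearEquiv 𝒜).toLinearMap
    have hp (y : g) : p y = DirectSum.decompose 𝒜 y j := rfl
    -- With `p` the projection onto degree `j`, only the degree `j` part of `y` survives, and `θ^ℂ`
    -- scales it by `ζ^j`.
    have hθ (y : g) : p.baseChange ℂ (thetaC 𝒜 ((1 : ℂ) ⊗ₜ[ℝ] y)) =
        ZMod.stdAddChar j • (1 : ℂ) ⊗ₜ[ℝ] p y := by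
      induction y using DirectSum.Decomposition.inductionOn 𝒜 with
      | zero => simp
      | add y y' hy hy' =>
        simp only [TensorProduct.tmul_add, map_add, smul_add, hy, hy']
      | @homogeneous i y =>
        rw [thetaC_one_tmul 𝒜 i y.2, map_smul, LinearMap.baseChange_tmul]
        obtain rfl | hij := eq_or_ne i j
        · rfl
        · rw [hp, DirectSum.decompose_of_mem_ne 𝒜 y.2 hij]
          simp
    have h' := hθ x
    -- Projecting `h` to degree `j` gives `(ζ^k - ζ^j) • (1 ⊗ p x) = 0`, and `ζ^k ≠ ζ^j`.
    rw [h, map_smul, LinearMap.baseChange_tmul, ← sub_eq_zero, ← sub_smul, smul_eq_zero,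
      sub_eq_zero] at h'
    refine one_tmul_injective ?_
    simpa [hp] using h'.resolve_left fun e => hj (ZMod.injective_stdAddChar e).symm
  rw [← hsum]
  refine sum_mem fun j _ => ?_
  obtain rfl | hj := eq_or_ne j k
  · exact SetLike.coe_mem _
  · rw [hzero j hj]
    exact zero_mem _

/-- `θ^ℂ (τ_u x) = τ_u (ζ^i x) = ζ^(-i) τ_u x` by R-compatibility and antilinearity. -/
theorem CartanInvolution.IsRCompatible.tau_mem {c : CartanInvolution g}
    (hc : c.IsRCompatible 𝒜) {i : ZMod m} {x : g} (hx : x ∈ 𝒜 i) : c.tau x ∈ 𝒜 (-i) := by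
  refine mem_of_thetaC_eq 𝒜 ?_
  rw [c.one_tmul_tau, ← hc, thetaC_one_tmul 𝒜 i hx, CartanInvolution.conj, conjugation_smul,
    AddChar.map_neg_eq_conj]

theorem CartanInvolution.IsRCompatible.tauC_mem {c : CartanInvolution g}
    (hc : c.IsRCompatible 𝒜) {i : ZMod m} {z : ℂ ⊗[ℝ] g} (hz : z ∈ (𝒜 i).baseChange ℂ) :
    c.tauC z ∈ (𝒜 (-i)).baseChange ℂ := by
  -- The base change is the range of `ℂ ⊗ g_i → ℂ ⊗ g`, so pure tensors `a ⊗ x` with `x ∈ g_i`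
  -- suffice.
  obtain ⟨w, rfl⟩ := hz
  induction w using TensorProduct.induction_on with
  | zero => simp
  | add a b ha hb => simpa only [map_add] using add_mem ha hb
  | tmul a x => exact Submodule.tmul_mem_baseChange_of_mem a (hc.tau_mem 𝒜 x.2)

end Gradation

end GradedLie

theorem corollary3 {g : Type*} [LieRing g] [LieAlgebra ℝ g] [FiniteDimensional ℝ g]
    [LieAlgebra.IsSemisimple ℝ g] {m : ℕ} [NeZero m]
    (𝒜 : ZMod m → Submodule ℝ g) [GradedLieAlgebra 𝒜]
    (c : GradedLie.CartanInvolution g) (hc : c.IsRCompatible 𝒜) (i : ZMod m) :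
    -- the real case
    (Set.BijOn c.tau (𝒜 i) (𝒜 (-i)) ∧
      (∀ e ∈ 𝒜 i, c.tau '' GradedLie.adOrbit (𝒜 0) e = GradedLie.adOrbit (𝒜 0) (c.tau e)) ∧
      Set.BijOn (fun O => c.tau '' O)
        (GradedLie.adOrbits (𝒜 0) (𝒜 i)) (GradedLie.adOrbits (𝒜 0) (𝒜 (-i)))) ∧
    -- the complex case
    ((∀ z : TensorProduct ℝ ℂ g, c.tauC z = c.conj (GradedLie.tauG g z)) ∧
      Set.BijOn c.tauC ((𝒜 i).baseChange ℂ) ((𝒜 (-i)).baseChange ℂ) ∧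
      (∀ e ∈ (𝒜 i).baseChange ℂ, c.tauC '' GradedLie.adOrbit ((𝒜 0).baseChange ℂ) e =
        GradedLie.adOrbit ((𝒜 0).baseChange ℂ) (c.tauC e)) ∧
      Set.BijOn (fun O => c.tauC '' O)
        (GradedLie.adOrbits ((𝒜 0).baseChange ℂ) ((𝒜 i).baseChange ℂ))
        (GradedLie.adOrbits ((𝒜 0).baseChange ℂ) ((𝒜 (-i)).baseChange ℂ))) := by
  have hneg {j : ZMod m} {x : g} (hx : x ∈ 𝒜 (-j)) : c.tau x ∈ 𝒜 j := by
    simpa using hc.tau_mem 𝒜 hx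
  have hnegC {j : ZMod m} {z : TensorProduct ℝ ℂ g} (hz : z ∈ (𝒜 (-j)).baseChange ℂ) :
      c.tauC z ∈ (𝒜 j).baseChange ℂ := by
    simpa using hc.tauC_mem 𝒜 hz
  -- Invariance of degree `0` is the case `j = 0`, where `-0 = 0`.
  exact ⟨GradedLie.involution_adOrbits c.tau c.tau_lie c.tau_tau
      (fun x hx => hneg (by simpa using hx)) (fun x hx => hc.tau_mem 𝒜 hx) (fun x hx => hneg hx),
    c.tauC_eq, GradedLie.involution_adOrbits c.tauC c.tauC_lie c.tauC_tauC
      (fun x hx => hnegC (by simpa using hx)) (fun x hx => hc.tauC_mem 𝒜 hx)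
      (fun x hx => hnegC hx)⟩
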